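/- Let $d > 2$ and $n > 1$ be integers such that every prime factor of $n$ exceeds $7$, and let $a$ be an integer with $\gcd(a,n)=1$. Let $$H_d(a;n)=\{(x_1,\dots,x_d)\in\mathbb{Z}^d : x_1\cdots x_d\equiv a \pmod n,\ 1\le x_1,\dots,x_d<n\}$$ be the $d$-dimensional modular hyperbola, and for $0\le m\le d$ let $$\bar S_d(m;a;n)=\{x_1+\cdots+x_m-x_{m+1}-\cdots-x_d \bmod n : (x_1,\dots,x_d)\in H_d(a;n)\}.$$ Then for every choice of signs $\varepsilon_1,\dots,\varepsilon_d\in\{1,-1\}$, every residue class modulo $n$ is of the form $\varepsilon_1x_1+\cdots+\varepsilon_dx_d \bmod n$ for some $(x_1,\dots,x_d)\in H_d(a;n)$. In particular, $\#\bar S_d(m;a;n)=n$ for every $m$ with $0\le m\le d$. -/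

import Mathlib

/-- The `d`-dimensional modular hyperbola `H_d(a;n)`: all integer points `(x_1, …, x_d)` with
`1 ≤ x_i < n` for every `i` and `x_1 ⋯ x_d ≡ a (mod n)`. -/
def modularHyperbola (d : ℕ) (a : ℤ) (n : ℕ) : Set (Fin d → ℤ) :=
  {x | (∀ i, 1 ≤ x i ∧ x i < (n : ℤ)) ∧ (∏ i, x i) ≡ a [ZMOD (n : ℤ)]}

/-- The generalized signed sumset of residues `x_1 + ⋯ + x_m - x_{m+1} - ⋯ - x_d mod n` over the
points of `H_d(a;n)`. The coordinates are indexed from `0`, so the first `m` of them are those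
of index less than `m`. -/
def signedSumset (d m : ℕ) (a : ℤ) (n : ℕ) : Set (ZMod n) :=
  (fun x : Fin d → ℤ => ((∑ i : Fin d, if (i : ℕ) < m then x i else -x i : ℤ) : ZMod n)) ''
    modularHyperbola d a n

/-!
The signs are absorbed into the coordinates, which changes `a` only by a sign, and all coordinates
but three are taken to be `1`. The task is then to solve `x + y + z = b`, `x * y * z = a` in
`ZMod n` for every unit `a` and every `b`, and by the Chinese remainder theorem `n` may be taken
to be a prime power `p ^ m`.

*Modulo `p`.* For fixed `z ≠ 0`, the remaining `x` and `y` are the roots of a quadratic, and they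
exist as soon as `z * (z * (b - z) ^ 2 - 4 * a)` is a square. Only the existence of a single such
`z` is needed, so the Hasse bound can be replaced by a short polynomial argument
(`exists_isSquare_quartic`). Put `k = (p - 1) / 2` and `g = X * (b - X) ^ 2 - 4 * a`. If no `z ≠ 0`
works, then `X ^ k * g ^ k` takes the value `-1` at all nonzero points, so `X ^ (2 * k) - 1`
divides `X ^ k * g ^ k + 1`. Comparing coefficients, `g ^ k` has coefficient `-2` at `X ^ k` and
`0` at `X ^ i` for `k < i < 2 * k`. But `h = g ^ k` satisfies `g * h' = k * g' * h`, a linear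
recurrence of order three on the coefficients, and for `k ≥ 4` (that is, `p > 7`) the three zeros
after `X ^ k` force the coefficient at `X ^ k` to vanish too.

*Modulo `p ^ m`.* A solution modulo `p` whose coordinates are not all equal is a smooth point, and
it lifts to `ℤ_[p]` by Hensel's lemma applied to the quadratic (`PadicInt.exists_sum_prod_eq`).
The coordinates can all be equal to some `s` only if `b = 3 * s` and `a = s ^ 3`, and in that case
`(-s / 2, -s / 2, 4 * s)` is another solution, with unequal coordinates since `p ≠ 3`.
-/

open Polynomial

/-! ### Solutions modulo a prime -/

/-- A polynomial of degree `4 * k` of the form `X ^ k * h` that is constantly `-1` on the nonzero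
elements of the field with `2 * k + 1` elements has prescribed coefficients in the middle range,
because it is congruent to `-1` modulo `X ^ (2 * k) - 1`. -/
lemma coeff_of_eval_eq_neg_one {p k : ℕ} [Fact p.Prime] (hk : p = 2 * k + 1) (hk0 : 0 < k)
    {h : (ZMod p)[X]} (hm : h.Monic) (hdeg : h.natDegree = 3 * k)
    (hev : ∀ z : ZMod p, z ≠ 0 → z ^ k * h.eval z = -1) :
    h.coeff k = -2 ∧ ∀ i, k < i → i < 2 * k → h.coeff i = 0 := by
  have hD : (X ^ (2 * k) - 1 : (ZMod p)[X]).Monic := monic_X_pow_sub_C 1 (by omega)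
  have hDdeg : (X ^ (2 * k) - 1 : (ZMod p)[X]).natDegree = 2 * k := natDegree_X_pow_sub_C
  set F : (ZMod p)[X] := X ^ k * h + 1 with hF
  have hlow (j : ℕ) (hj : 0 < j) (hjk : j < k) : F.coeff j = 0 := by
    rw [hF, coeff_add, coeff_X_pow_mul', coeff_one, if_neg (by omega), if_neg (by omega), add_zero]
  have hhigh (j : ℕ) : F.coeff (j + k) = h.coeff j + (if j + k = 0 then 1 else 0) := by
    rw [hF, coeff_add, coeff_X_pow_mul, coeff_one]
  have hrem : F %ₘ (X ^ (2 * k) - 1) = 0 := by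
    apply eq_zero_of_natDegree_lt_card_of_eval_eq_zero' _ (Finset.univ.erase (0 : ZMod p))
    · intro z hz
      have hz : z ≠ 0 := by simpa using hz
      have h1 : z ^ (2 * k) = 1 := by
        rw [show 2 * k = p - 1 by omega]
        exact ZMod.pow_card_sub_one_eq_one hz
      have h2 := congrArg (eval z) (modByMonic_add_div F (X ^ (2 * k) - 1))
      simpa [hF, h1, hev z hz] using h2
    · rw [Finset.card_erase_of_mem (Finset.mem_univ _), Finset.card_univ, ZMod.card]
      have := natDegree_modByMonic_lt F hD (by
        intro h1
        have := congrArg natDegree h1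
        rw [hDdeg, natDegree_one] at this
        omega)
      omega
  set Q := F /ₘ (X ^ (2 * k) - 1) with hQ
  have hFQ : F = X ^ (2 * k) * Q - Q := by
    have := modByMonic_add_div F (X ^ (2 * k) - 1)
    rw [hrem, zero_add] at this
    rw [← this]
    ring
  have hFdeg : F.natDegree = 4 * k := by
    have h1 : (X ^ k * h).natDegree = 4 * k := by
      rw [natDegree_X_pow_mul _ hm.ne_zero, hdeg]
      ring
    rw [hF, natDegree_add_eq_left_of_natDegree_lt (by rw [natDegree_one]; omega), h1]
  have hQdeg : Q.natDegree = 2 * k := by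
    rw [hQ, natDegree_divByMonic F hD, hFdeg, hDdeg]
    omega
  have hc (j : ℕ) : F.coeff (j + 2 * k) = Q.coeff j - Q.coeff (j + 2 * k) := by
    rw [hFQ, coeff_sub, coeff_X_pow_mul]
  have hc' (j : ℕ) (hj : j < 2 * k) : F.coeff j = - Q.coeff j := by
    rw [hFQ, coeff_sub, coeff_X_pow_mul', if_neg (by omega), zero_sub]
  have hQ0 : Q.coeff 0 = -1 := by
    have h1 : F.coeff 0 = 1 := by
      rw [hF, coeff_add, coeff_X_pow_mul', if_neg (by omega), coeff_one_zero, zero_add]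
    have h2 := hc' 0 (by omega)
    rw [h1] at h2
    rw [h2, neg_neg]
  have hQtop : Q.coeff (2 * k) = 1 := by
    have h1 : F.coeff (2 * k + 2 * k) = 1 := by
      rw [show 2 * k + 2 * k = 3 * k + k by ring, hhigh, if_neg (by omega), ← hdeg, add_zero]
      exact hm
    rw [hc, coeff_eq_zero_of_natDegree_lt (by omega : Q.natDegree < 2 * k + 2 * k)] at h1
    simpa using h1
  constructor
  · have h1 := hc 0
    rw [zero_add, hQ0, hQtop, two_mul, hhigh, if_neg (by omega)] at h1
    linear_combination h1
  · intro i hi hi'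
    have h1 := hhigh i
    rw [if_neg (by omega), add_zero] at h1
    obtain ⟨j, rfl⟩ : ∃ j, i = j + k := ⟨i - k, by omega⟩
    rw [← h1, show j + k + k = j + 2 * k by ring, hc,
      coeff_eq_zero_of_natDegree_lt (by omega : Q.natDegree < j + 2 * k), sub_zero]
    have h2 := hc' j (by omega)
    rw [hlow j (by omega) (by omega)] at h2
    exact neg_eq_zero.mp h2.symm

/-- The quartic curve `w ^ 2 = z * (z * (b - z) ^ 2 - 4 * a)` has a point with `z ≠ 0` over every
prime field of characteristic greater than `7`. -/
lemma exists_isSquare_quartic {p : ℕ} [Fact p.Prime] (hp : 7 < p) (a b : ZMod p) :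
    ∃ z : ZMod p, z ≠ 0 ∧ IsSquare (z * (z * (b - z) ^ 2 - 4 * a)) := by
  by_contra! hcon
  obtain ⟨k, hk⟩ : Odd p := (Fact.out : p.Prime).odd_of_ne_two (by omega)
  have hk4 : 4 ≤ k := by omega
  set g : (ZMod p)[X] := X ^ 3 + C (-2 * b) * X ^ 2 + C (b ^ 2) * X + C (-4 * a) with hg
  have hgdeg : g.natDegree = 3 := by rw [hg]; compute_degree!
  have hgm : g.Monic := by rw [hg]; monicity!
  have hev (z : ZMod p) (hz : z ≠ 0) : z ^ k * (g ^ k).eval z = -1 := by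
    have hns := hcon z hz
    have h0 : z * (z * (b - z) ^ 2 - 4 * a) ≠ 0 := fun h => hns (h ▸ IsSquare.zero)
    have hpk : p / 2 = k := by omega
    rw [ZMod.euler_criterion p h0] at hns
    have h1 := (ZMod.pow_div_two_eq_neg_one_or_one p h0).resolve_left hns
    rw [hpk] at h1
    rw [eval_pow, ← mul_pow, ← h1, hg]
    simp only [eval_add, eval_mul, eval_pow, eval_X, eval_C]
    ring
  obtain ⟨hk2, hk0⟩ := coeff_of_eval_eq_neg_one hk (by omega) (hgm.pow k)
    (by rw [hgm.natDegree_pow, hgdeg, mul_comm]) hev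
  have hode : g * derivative (g ^ k) = C (k : ZMod p) * derivative g * g ^ k := by
    obtain ⟨m, rfl⟩ : ∃ m, k = m + 1 := ⟨k - 1, by omega⟩
    rw [derivative_pow_succ]
    push_cast
    ring
  have h2k : 2 * (k : ZMod p) + 1 = 0 := by
    have h1 : ((2 * k + 1 : ℕ) : ZMod p) = 0 := by rw [← hk, ZMod.natCast_self]
    exact_mod_cast h1
  set h := g ^ k
  have hg' : derivative g = 3 * X ^ 2 + C (-4 * b) * X + C (b ^ 2) := by
    rw [hg]
    simp only [derivative_add, derivative_C_mul, derivative_C, derivative_X_pow, derivative_X]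
    simp only [C_mul, C_neg, Nat.cast_ofNat, C_ofNat]
    ring
  -- The coefficient at `X ^ (k + 2)` involves the coefficients of `h` from `k` to `k + 3` only.
  have hcoef := congrArg (fun q => coeff q (k + 2)) hode
  have e1 : g * derivative h = derivative h * X ^ 3 + C (-2 * b) * (derivative h * X ^ 2)
      + C (b ^ 2) * (derivative h * X) + C (-4 * a) * derivative h := by rw [hg]; ring
  have e2 : C (k : ZMod p) * derivative g * h = C (3 * k : ZMod p) * (h * X ^ 2)
      + C (k * (-4 * b)) * (h * X) + C (k * b ^ 2) * h := by
    rw [hg']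
    simp only [C_mul, C_ofNat]
    ring
  have e3 : (derivative h * X ^ 3).coeff (k + 2) = k * h.coeff k := by
    obtain ⟨m, rfl⟩ : ∃ m, k = m + 1 := ⟨k - 1, by omega⟩
    rw [show m + 1 + 2 = m + 3 by ring, coeff_mul_X_pow, coeff_derivative]
    push_cast
    ring
  simp only [e1, e2, coeff_add, coeff_C_mul, e3] at hcoef
  rw [coeff_mul_X_pow, coeff_mul_X_pow, show k + 2 = k + 1 + 1 by ring, coeff_mul_X, coeff_mul_X,
    coeff_derivative, coeff_derivative, coeff_derivative, hk0 (k + 1) (by omega) (by omega),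
    hk0 (k + 1 + 1) (by omega) (by omega), hk0 (k + 1 + 1 + 1) (by omega) (by omega), hk2] at hcoef
  -- What remains is `k * (-2) = 3 * k * (-2)` with `2 * k = -1`, that is `1 = 3`.
  have h2 : ((2 : ℕ) : ZMod p) = 0 := by
    push_cast
    linear_combination 2 * h2k - hcoef
  rw [ZMod.natCast_eq_zero_iff] at h2
  exact absurd (Nat.le_of_dvd two_pos h2) (by omega)

/-- Some solution modulo `p` has two distinct coordinates, which makes it a smooth point of the
curve. -/
lemma ZMod.exists_sum_prod_eq_ne {p : ℕ} [Fact p.Prime] (hp : 7 < p) (a b : ZMod p) :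
    ∃ x y z : ZMod p, x + y + z = b ∧ x * y * z = a ∧ x ≠ y := by
  have hne (m : ℕ) (hm : m ∣ 6) : (m : ZMod p) ≠ 0 := by
    intro h
    rw [ZMod.natCast_eq_zero_iff] at h
    exact absurd (Nat.le_of_dvd (by norm_num) (h.trans hm)) (by omega)
  have h2 : (2 : ZMod p) ≠ 0 := by exact_mod_cast hne 2 (by norm_num)
  have h3 : (3 : ZMod p) ≠ 0 := by exact_mod_cast hne 3 (by norm_num)
  obtain ⟨z, hz, w, hw⟩ := exists_isSquare_quartic hp a b
  obtain ⟨x, hx⟩ : ∃ x, 2 * z * x = z * (b - z) + w :=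
    ⟨(z * (b - z) + w) / (2 * z), by field_simp⟩
  have hprod : x * (b - z - x) * z = a := by
    apply mul_left_cancel₀ (mul_ne_zero (mul_ne_zero h2 h2) hz)
    linear_combination (-2 * z * x + z * (b - z) - w) * hx + hw
  by_cases hxy : x = b - z - x
  · by_cases hxz : x = z
    · -- All coordinates are equal to `x`, so the second solution of the nodal cubic is used.
      subst hxz
      have hb : b = 3 * x := by linear_combination -hxy
      refine ⟨4 * x, -x / 2, -x / 2, ?_, ?_, ?_⟩
      · rw [hb]
        field_simp
        ring
      · rw [← hprod, hb]
        field_simp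
        ring
      · intro h
        field_simp at h
        have h9 : 3 * (3 * x) = 0 := by linear_combination x * h
        exact mul_ne_zero h3 (mul_ne_zero h3 hz) h9
    · exact ⟨x, z, b - z - x, by ring, by linear_combination hprod, hxz⟩
  · exact ⟨x, b - z - x, z, by ring, hprod, hxy⟩

/-! ### Lifting to prime powers and composite moduli -/

lemma PadicInt.toZMod_eq_zero_iff_norm_lt_one {p : ℕ} [Fact p.Prime] (u : ℤ_[p]) :
    toZMod u = 0 ↔ ‖u‖ < 1 := by
  rw [← RingHom.mem_ker, ker_toZMod, IsLocalRing.mem_maximalIdeal, mem_nonunits]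

lemma PadicInt.norm_eq_one_of_toZMod_ne_zero {p : ℕ} [Fact p.Prime] {u : ℤ_[p]}
    (hu : toZMod u ≠ 0) : ‖u‖ = 1 :=
  le_antisymm (norm_le_one u) (not_lt.mp (mt (toZMod_eq_zero_iff_norm_lt_one u).mpr hu))

lemma PadicInt.exists_sum_prod_eq {p : ℕ} [Fact p.Prime] (hp : 7 < p) (a b : ℤ_[p])
    (ha : toZMod a ≠ 0) : ∃ x y z : ℤ_[p], x + y + z = b ∧ x * y * z = a := by
  obtain ⟨x₀, y₀, z₀, hs, hm, hxy⟩ := ZMod.exists_sum_prod_eq_ne hp (toZMod a) (toZMod b)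
  obtain ⟨x, rfl⟩ := ZMod.ringHom_surjective toZMod x₀
  obtain ⟨z, rfl⟩ := ZMod.ringHom_surjective toZMod z₀
  obtain rfl : y₀ = toZMod b - toZMod z - toZMod x := by linear_combination hs
  have hz : toZMod z ≠ 0 := by
    intro h
    rw [h, mul_zero] at hm
    exact ha hm.symm
  -- The quadratic is left non-monic, which avoids dividing by `z`.
  set F : ℤ_[p][X] := C z * X ^ 2 - C (z * (b - z)) * X + C a with hF
  have hFe (t : ℤ_[p]) : F.aeval t = z * t ^ 2 - z * (b - z) * t + a := by
    simp [hF]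
  have hFd : F.derivative.aeval x = z * (2 * x - (b - z)) := by
    simp [hF]
    ring
  have hd : ‖F.derivative.aeval x‖ = 1 := by
    apply norm_eq_one_of_toZMod_ne_zero
    rw [hFd, map_mul]
    refine mul_ne_zero hz fun h => hxy ?_
    simp only [map_sub, map_mul, map_ofNat] at h
    linear_combination h
  have h0 : ‖F.aeval x‖ < 1 := by
    rw [← toZMod_eq_zero_iff_norm_lt_one, hFe]
    simp only [map_add, map_sub, map_mul, map_pow]
    linear_combination -hm
  obtain ⟨t, ht, -⟩ := hensels_lemma (F := F) (a := x) (by rw [hd]; simpa using h0)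
  rw [hFe] at ht
  exact ⟨t, b - z - t, z, by ring, by linear_combination -ht⟩

lemma ZMod.exists_sum_prod_eq (n : ℕ) (hn : n ≠ 0) (hprime : ∀ p : ℕ, p.Prime → p ∣ n → 7 < p)
    (a b : ℤ) (ha : IsCoprime a (n : ℤ)) :
    ∃ x y z : ZMod n, x + y + z = b ∧ x * y * z = a := by
  induction n using Nat.recOnPosPrimePosCoprime with
  | zero => exact absurd rfl hn
  | one => exact ⟨0, 0, 0, Subsingleton.elim _ _, Subsingleton.elim _ _⟩
  | prime_pow p k hp hk =>
    have := Fact.mk hp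
    have hpk : p ∣ p ^ k := dvd_pow_self p hk.ne'
    obtain ⟨x, y, z, hs, hm⟩ := PadicInt.exists_sum_prod_eq (hprime p hp hpk) (a : ℤ_[p]) b (by
      rw [map_intCast, Ne, ZMod.intCast_zmod_eq_zero_iff_dvd]
      intro h
      have h1 := ha.isUnit_of_dvd' h (by exact_mod_cast hpk)
      exact (Nat.prime_iff_prime_int.mp hp).not_isUnit h1)
    refine ⟨PadicInt.toZModPow k x, PadicInt.toZModPow k y, PadicInt.toZModPow k z, ?_, ?_⟩
    · rw [← map_add, ← map_add, hs, map_intCast]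
    · rw [← map_mul, ← map_mul, hm, map_intCast]
  | coprime m₁ m₂ h₁ h₂ hc ih₁ ih₂ =>
    push_cast at ha
    obtain ⟨x₁, y₁, z₁, hs₁, hm₁⟩ := ih₁ (by omega)
      (fun p hp h => hprime p hp (h.mul_right _)) ha.of_mul_right_left
    obtain ⟨x₂, y₂, z₂, hs₂, hm₂⟩ := ih₂ (by omega)
      (fun p hp h => hprime p hp (h.mul_left _)) ha.of_mul_right_right
    let e := ZMod.chineseRemainder hc
    refine ⟨e.symm (x₁, x₂), e.symm (y₁, y₂), e.symm (z₁, z₂), ?_, ?_⟩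
    · apply e.injective
      simp only [map_add, RingEquiv.apply_symm_apply, map_intCast]
      exact Prod.ext (by simpa using hs₁) (by simpa using hs₂)
    · apply e.injective
      simp only [map_mul, RingEquiv.apply_symm_apply, map_intCast]
      exact Prod.ext (by simpa using hm₁) (by simpa using hm₂)

/-! ### Signed sums on the modular hyperbola -/

lemma exists_mem_modularHyperbola_signed_sum_eq {d n : ℕ} {a : ℤ} (hd : 2 < d) (hn : 1 < n)
    (hprime : ∀ p : ℕ, p.Prime → p ∣ n → 7 < p) (ha : Int.gcd a (n : ℤ) = 1)
    (ε : Fin d → ℤˣ) (b : ZMod n) :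
    ∃ x ∈ modularHyperbola d a n, ((∑ i, (ε i : ℤ) * x i : ℤ) : ZMod n) = b := by
  have : Fact (1 < n) := ⟨hn⟩
  have : NeZero n := ⟨by omega⟩
  have ha' : IsCoprime a (n : ℤ) := Int.isCoprime_iff_gcd_eq_one.mpr ha
  have hε (i : Fin d) : (((ε i : ℤˣ) : ℤ) : ZMod n) * (ε i : ℤ) = 1 := by
    rw [← Int.cast_mul, Int.units_coe_mul_self, Int.cast_one]
  obtain ⟨e, rfl⟩ : ∃ e, d = e + 3 := ⟨d - 3, by omega⟩
  obtain ⟨x, y, z, hs, hm⟩ := ZMod.exists_sum_prod_eq n (by omega) hprime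
    (((∏ i, ε i : ℤˣ) : ℤ) * a) ((b.val : ℤ) - e)
    ((isCoprime_mul_unit_left_left (∏ i, ε i).isUnit a n).mpr ha')
  -- `u i` is the signed coordinate `ε i * x i`.
  let u : Fin (e + 3) → ZMod n := Fin.cons x (Fin.cons y (Fin.cons z fun _ => 1))
  have hus : ∑ i, u i = b := by
    simp only [u, Fin.sum_univ_succ, Fin.cons_zero, Fin.cons_succ, Finset.sum_const,
      Finset.card_univ, Fintype.card_fin, nsmul_eq_mul, mul_one]
    push_cast [ZMod.natCast_zmod_val] at hs
    linear_combination hs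
  have hum : ∏ i, u i = (((∏ i, ε i : ℤˣ) : ℤ) : ZMod n) * a := by
    simp only [u, Fin.prod_univ_succ, Fin.cons_zero, Fin.cons_succ, Finset.prod_const_one] at hm ⊢
    push_cast at hm ⊢
    linear_combination hm
  let v : Fin (e + 3) → ZMod n := fun i => ((ε i : ℤ) : ZMod n) * u i
  have hvm : ∏ i, v i = a := by
    simp only [v, Finset.prod_mul_distrib, hum]
    rw [Units.coe_prod, Int.cast_prod, ← mul_assoc, ← Finset.prod_mul_distrib,
      Finset.prod_congr rfl fun i _ => hε i, Finset.prod_const_one, one_mul]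
  have hau : IsUnit (a : ZMod n) := by
    rwa [ZMod.coe_int_isUnit_iff_isCoprime, isCoprime_comm]
  have hv0 (i : Fin (e + 3)) : v i ≠ 0 := by
    intro h
    rw [Finset.prod_eq_zero (Finset.mem_univ i) h] at hvm
    exact hau.ne_zero hvm.symm
  refine ⟨fun i => ((v i).val : ℤ), ⟨fun i => ⟨?_, ?_⟩, ?_⟩, ?_⟩
  · exact Int.natCast_pos.mpr (ZMod.val_pos.mpr (hv0 i))
  · exact Int.ofNat_lt.mpr (ZMod.val_lt (v i))
  · rw [← ZMod.intCast_eq_intCast_iff]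
    push_cast [ZMod.natCast_zmod_val]
    exact hvm
  · push_cast [ZMod.natCast_zmod_val]
    rw [← hus]
    refine Finset.sum_congr rfl fun i _ => ?_
    rw [← mul_assoc, hε, one_mul]

theorem mainTheorem1 (d n : ℕ) (a : ℤ) (hd : 2 < d) (hn : 1 < n)
    (hprime : ∀ p : ℕ, p.Prime → p ∣ n → 7 < p) (ha : Int.gcd a (n : ℤ) = 1) :
    (∀ (ε : Fin d → ℤˣ) (b : ZMod n), ∃ x ∈ modularHyperbola d a n,
      ((∑ i, (ε i : ℤ) * x i : ℤ) : ZMod n) = b) ∧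
    ∀ m : ℕ, m ≤ d → (signedSumset d m a n).ncard = n := by
  refine ⟨exists_mem_modularHyperbola_signed_sum_eq hd hn hprime ha, fun m _ => ?_⟩
  have huniv : signedSumset d m a n = Set.univ := by
    refine Set.eq_univ_of_forall fun b => ?_
    obtain ⟨x, hx, hxb⟩ := exists_mem_modularHyperbola_signed_sum_eq hd hn hprime ha
      (fun i => if (i : ℕ) < m then 1 else -1) b
    refine ⟨x, hx, hxb ▸ congrArg Int.cast (Finset.sum_congr rfl fun i _ => ?_)⟩
    split_ifs <;> simp
  rw [huniv, Set.ncard_univ, Nat.card_zmod]
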